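/- Let $\mathbb{F}_q$ be a finite field with $q$ elements, $\Lambda=\mathbb{F}_q[T]$, and let $F=\mathbb{F}_q((T^{-1}))$ be the field of formal Laurent series in $T^{-1}$, with the absolute value $|0|=0$ and $|a|=e^{k_0}$ for $a=\sum_{k\le k_0}a_kT^k$ with $a_{k_0}\neq 0$, and the topology it induces. Let $\lambda$ be a Haar measure on $(F,+)$ and let $n\ge 1$ be an integer. For $\varepsilon>0$, a vector $y=(y_1,\dots,y_n)\in F^n$ is called Dirichlet $\varepsilon$-improvable if there is $t_0>0$ such that for all nonnegative integers $t_1,\dots,t_n$ with $\max\{t,t_1,\dots,t_n\}>t_0$, where $t=t_1+\dots+t_n$, there is a nonzero $(p,q_1,\dots,q_n)\in\Lambda\times\Lambda^n$ with $$|y_1q_1+\dots+y_nq_n-p|<\frac{\varepsilon}{e^{t}}\quad\text{and}\quad |q_j|<\varepsilon e^{t_j}\ \text{ for } j=1,\dots,n.$$ Theorem 1.2. Let $f_1,\dots,f_n\in F[x]$ be polynomials such that $1,f_1,\dots,f_n$ are linearly independent over $F$, let $U\subseteq F$ be open, and put $\mathbf f(x)=(f_1(x),\dots,f_n(x))$ for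 $x\in U$. Then there exists $\varepsilon_0>0$ such that for every $\varepsilon$ with $0<\varepsilon<\varepsilon_0$, the vector $\mathbf f(x)$ is not Dirichlet $\varepsilon$-improvable for $\lambda$-almost every $x\in U$. -/

import Mathlib

open MeasureTheory

namespace FunctionFieldDirichlet

noncomputable section

/-- The field `F = k((T⁻¹))` of formal Laurent series in `T⁻¹` over `k`. The indeterminate of
Mathlib's `LaurentSeries` plays the role of `T⁻¹`, so the coefficient of `T ^ j` in `a` is
`a.coeff (-j)`. The field structure and the (valuation) topology are Mathlib's. -/
abbrev F (k : Type*) [Field k] : Type _ := LaurentSeries k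

/-- The element `T` of `F`. -/
def T (k : Type*) [Field k] : F k := HahnSeries.single (-1 : ℤ) (1 : k)

/-- The embedding of `Λ = k[T]` into `F`, sending the indeterminate to `T` and constants to
constants. -/
def ofPoly (k : Type*) [Field k] : Polynomial k →+* F k :=
  Polynomial.eval₂RingHom (HahnSeries.C : k →+* F k) (T k)

open scoped Classical in
/-- The absolute value on `F`: `|0| = 0`, and `|a| = e ^ (deg a)` for `a ≠ 0`, where `deg a` is the
largest `j` with a nonzero coefficient at `T ^ j`, that is, minus the order of `a` in `T⁻¹`. -/
def absF {k : Type*} [Field k] (a : F k) : ℝ :=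
  if a = 0 then 0 else Real.exp (-(a.order : ℝ))

/-- `y ∈ Fⁿ` is Dirichlet `ε`-improvable: there is `t₀ > 0` such that for all nonnegative integers
`t₁, …, tₙ` with `max {t, t₁, …, tₙ} > t₀`, where `t = t₁ + ⋯ + tₙ`, some nonzero
`(p, q₁, …, qₙ) ∈ Λ × Λⁿ` satisfies `|y₁ q₁ + ⋯ + yₙ qₙ - p| < ε / e ^ t` and
`|q_j| < ε e ^ (t_j)` for all `j`. -/
def DirichletImprovable {k : Type*} [Field k] {n : ℕ} (ε : ℝ) (y : Fin n → F k) : Prop :=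
  ∃ t₀ : ℝ, 0 < t₀ ∧ ∀ t : Fin n → ℕ,
    (t₀ < ((∑ j, t j : ℕ) : ℝ) ∨ ∃ j, t₀ < (t j : ℝ)) →
      ∃ (p : Polynomial k) (q : Fin n → Polynomial k), (p, q) ≠ 0 ∧
        absF ((∑ j, y j * ofPoly k (q j)) - ofPoly k p)
            < ε / Real.exp ((∑ j, t j : ℕ) : ℝ) ∧
        ∀ j, absF (ofPoly k (q j)) < ε * Real.exp (t j : ℝ)

end

end FunctionFieldDirichlet

/-!
The definition of improvability quantifies over every `t ∈ ℕⁿ` with `max {t, t₁, …, tₙ}` large, so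
in particular over those supported at the first coordinate, `t = (m, 0, …, 0)`. For such `t` and
`ε < 1` the conditions `|q_j| < ε` with `j ≥ 2` force `q_j = 0`, because a nonzero polynomial has
absolute value at least `1` (`one_le_absF_ofPoly`). Hence `y₁` alone has, for every large `m`,
an approximation `|y₁ q - p| < ε e⁻ᵐ` with `q ≠ 0` and `|q| < ε eᵐ`.

Two consecutive such approximations `p / q` and `p' / q'` satisfy `|p q' - p' q| < ε² e < 1` once
`ε < e⁻¹`, so they agree. All of them are therefore one fraction, which approximates `y₁` arbitrarily
well and so equals it: an improvable vector has a rational first coordinate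
(`DirichletImprovable.exists_rational`).

As `k` is finite there are only countably many rational elements of `F`, and the polynomial `f₁`,
which is not constant because `1, f₁` are linearly independent, takes each of them finitely often.
The set of `x` for which `𝐟(x)` is improvable is thus countable, and Haar measure on `F` has no atoms
(`addHaar_nullSingletonClass`). So `ε₀ = e⁻¹` works for every choice of the `fᵢ`.
-/

namespace FunctionFieldDirichlet

open Filter Topology

variable {k : Type*} [Field k]

/-! ### The absolute value -/

theorem absF_nonneg (a : F k) : 0 ≤ absF a := by
  unfold absF; split_ifs <;> positivity

@[simp]
theorem absF_zero : absF (0 : F k) = 0 := by simp [absF]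

theorem absF_of_ne_zero {a : F k} (ha : a ≠ 0) : absF a = Real.exp (-(a.order : ℝ)) := by
  simp [absF, ha]

theorem absF_pos {a : F k} (ha : a ≠ 0) : 0 < absF a := by
  rw [absF_of_ne_zero ha]; positivity

theorem absF_mul (a b : F k) : absF (a * b) = absF a * absF b := by
  by_cases ha : a = 0
  · simp [ha]
  by_cases hb : b = 0
  · simp [hb]
  rw [absF_of_ne_zero ha, absF_of_ne_zero hb, absF_of_ne_zero (mul_ne_zero ha hb),
    HahnSeries.order_mul ha hb, ← Real.exp_add]
  push_cast
  congr 1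
  ring

theorem absF_neg (a : F k) : absF (-a) = absF a := by
  by_cases ha : a = 0
  · simp [ha]
  rw [absF_of_ne_zero ha, absF_of_ne_zero (neg_ne_zero.2 ha), HahnSeries.order_neg]

theorem absF_add_le (a b : F k) : absF (a + b) ≤ max (absF a) (absF b) := by
  by_cases ha : a = 0
  · simp [ha]
  by_cases hb : b = 0
  · simp [hb]
  by_cases hab : a + b = 0
  · rw [hab, absF_zero]
    exact le_max_of_le_left (absF_nonneg a)
  have h := HahnSeries.min_order_le_order_add hab
  rw [absF_of_ne_zero ha, absF_of_ne_zero hb, absF_of_ne_zero hab]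
  rcases min_le_iff.1 h with h | h
  · exact le_max_of_le_left (Real.exp_le_exp.2 (neg_le_neg (Int.cast_le.2 h)))
  · exact le_max_of_le_right (Real.exp_le_exp.2 (neg_le_neg (Int.cast_le.2 h)))

theorem absF_sub_le (a b : F k) : absF (a - b) ≤ max (absF a) (absF b) := by
  rw [sub_eq_add_neg, ← absF_neg b]
  exact absF_add_le a (-b)

/-! ### Polynomials inside the field of Laurent series -/

theorem coeff_ofPoly_neg (p : Polynomial k) (m : ℕ) :
    (ofPoly k p).coeff (-(m : ℤ)) = p.coeff m := by
  induction p using Polynomial.induction_on' with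
  | add p q hp hq => rw [map_add, HahnSeries.coeff_add, hp, hq, Polynomial.coeff_add]
  | monomial i a =>
    simp only [ofPoly, T, Polynomial.coe_eval₂RingHom, Polynomial.eval₂_monomial,
      HahnSeries.single_pow, one_pow, HahnSeries.C_apply, HahnSeries.single_mul_single, mul_one,
      Polynomial.coeff_monomial, HahnSeries.coeff_single]
    have h : -(m : ℤ) = 0 + i • (-1 : ℤ) ↔ i = m := by
      rw [nsmul_eq_mul]; omega
    simp only [h]

theorem one_le_absF_ofPoly {p : Polynomial k} (hp : p ≠ 0) : 1 ≤ absF (ofPoly k p) := by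
  have hc : (ofPoly k p).coeff (-(p.natDegree : ℤ)) ≠ 0 := by
    rw [coeff_ofPoly_neg]
    exact Polynomial.leadingCoeff_ne_zero.2 hp
  have h0 : ofPoly k p ≠ 0 := by
    intro h
    simp [h] at hc
  have hord : (ofPoly k p).order ≤ 0 :=
    (HahnSeries.order_le_of_coeff_ne_zero hc).trans (by omega)
  rw [absF_of_ne_zero h0]
  exact Real.one_le_exp (neg_nonneg.2 (Int.cast_nonpos.2 hord))

theorem ofPoly_ne_zero {p : Polynomial k} (hp : p ≠ 0) : ofPoly k p ≠ 0 := by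
  intro h
  have := one_le_absF_ofPoly hp
  rw [h, absF_zero] at this
  linarith

theorem eq_zero_of_absF_ofPoly_lt_one {p : Polynomial k} (h : absF (ofPoly k p) < 1) : p = 0 := by
  by_contra hp
  exact absurd (one_le_absF_ofPoly hp) (not_le.2 h)

/-! ### Improvable vectors have a rational coordinate -/

/-- A single element that is uniformly well approximable with `ε < e⁻¹` is a quotient of two
polynomials: consecutive approximations coincide. -/
theorem exists_rational_of_uniform_approx {ε : ℝ} (hε : 0 < ε) (hε' : ε < Real.exp (-1))
    {y : F k} {M : ℕ}
    (h : ∀ m : ℕ, M ≤ m → ∃ p q : Polynomial k, q ≠ 0 ∧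
      absF (y * ofPoly k q - ofPoly k p) < ε / Real.exp (m : ℝ) ∧
      absF (ofPoly k q) < ε * Real.exp (m : ℝ)) :
    ∃ p q : Polynomial k, y = ofPoly k p / ofPoly k q := by
  choose! P Q hQ hP hQlt using h
  have hε1 : ε < 1 := hε'.trans (by rw [Real.exp_lt_one_iff]; norm_num)
  have hεe : ε * Real.exp 1 < 1 := by
    calc ε * Real.exp 1 < Real.exp (-1) * Real.exp 1 := by gcongr
      _ = 1 := by rw [← Real.exp_add]; simp
  have step : ∀ m, M ≤ m →
      ofPoly k (P (m + 1)) / ofPoly k (Q (m + 1)) = ofPoly k (P m) / ofPoly k (Q m) := by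
    intro m hm
    have hm' : M ≤ m + 1 := hm.trans (Nat.le_succ m)
    have hexp : Real.exp ((m + 1 : ℕ) : ℝ) = Real.exp m * Real.exp 1 := by
      rw [← Real.exp_add]; push_cast; rfl
    have he : 1 < Real.exp 1 := Real.one_lt_exp_iff.2 one_pos
    have h1 :
        absF (ofPoly k (Q m)) * absF (y * ofPoly k (Q (m + 1)) - ofPoly k (P (m + 1))) < 1 := by
      calc _ < (ε * Real.exp m) * (ε / Real.exp ((m + 1 : ℕ) : ℝ)) :=
            mul_lt_mul'' (hQlt m hm) (hP (m + 1) hm') (absF_nonneg _) (absF_nonneg _)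
        _ = ε * (ε / Real.exp 1) := by rw [hexp]; field_simp
        _ ≤ ε * (ε / 1) := by gcongr
        _ < 1 := by nlinarith
    have h2 : absF (ofPoly k (Q (m + 1))) * absF (y * ofPoly k (Q m) - ofPoly k (P m)) < 1 := by
      calc _ < (ε * Real.exp ((m + 1 : ℕ) : ℝ)) * (ε / Real.exp m) :=
            mul_lt_mul'' (hQlt (m + 1) hm') (hP m hm) (absF_nonneg _) (absF_nonneg _)
        _ = ε * (ε * Real.exp 1) := by rw [hexp]; field_simp
        _ < 1 := by nlinarith
    -- The determinant of two consecutive solutions is a polynomial of absolute value below `1`.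
    have hdet : P m * Q (m + 1) - P (m + 1) * Q m = 0 := by
      apply eq_zero_of_absF_ofPoly_lt_one
      have hid : ofPoly k (P m * Q (m + 1) - P (m + 1) * Q m) =
          ofPoly k (Q m) * (y * ofPoly k (Q (m + 1)) - ofPoly k (P (m + 1))) -
            ofPoly k (Q (m + 1)) * (y * ofPoly k (Q m) - ofPoly k (P m)) := by
        simp only [map_sub, map_mul]; ring
      rw [hid]
      refine (absF_sub_le _ _).trans_lt (max_lt ?_ ?_)
      · rwa [absF_mul]
      · rwa [absF_mul]
    rw [div_eq_div_iff (ofPoly_ne_zero (hQ _ hm')) (ofPoly_ne_zero (hQ _ hm)), ← map_mul, ← map_mul,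
      sub_eq_zero.1 hdet]
  have hconst : ∀ m, M ≤ m →
      ofPoly k (P m) / ofPoly k (Q m) = ofPoly k (P M) / ofPoly k (Q M) := by
    intro m hm
    induction m, hm using Nat.le_induction with
    | base => rfl
    | succ m hm ih => rw [step m hm, ih]
  refine ⟨P M, Q M, ?_⟩
  by_contra hne
  have hδ : 0 < absF (y - ofPoly k (P M) / ofPoly k (Q M)) := absF_pos (sub_ne_zero.2 hne)
  have hlim : Tendsto (fun m : ℕ => ε / Real.exp (m : ℝ)) atTop (𝓝 0) :=
    tendsto_const_nhds.div_atTop (Real.tendsto_exp_atTop.comp tendsto_natCast_atTop_atTop)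
  obtain ⟨m, hmδ, hmM⟩ :=
    ((hlim.eventually (gt_mem_nhds hδ)).and (eventually_ge_atTop M)).exists
  have hq0 := ofPoly_ne_zero (hQ m hmM)
  have heq : y * ofPoly k (Q m) - ofPoly k (P m) =
      ofPoly k (Q m) * (y - ofPoly k (P M) / ofPoly k (Q M)) := by
    rw [← hconst m hmM]; field_simp
  have hlt := hP m hmM
  rw [heq, absF_mul] at hlt
  nlinarith [one_le_absF_ofPoly (hQ m hmM)]

/-- Testing improvability only on `t` supported at `i` shows that the `i`-th coordinate is a quotient
of two polynomials. -/
theorem DirichletImprovable.exists_rational {n : ℕ} {ε : ℝ} (hε : 0 < ε) (hε' : ε < Real.exp (-1))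
    {y : Fin n → F k} (h : DirichletImprovable ε y) (i : Fin n) :
    ∃ p q : Polynomial k, y i = ofPoly k p / ofPoly k q := by
  obtain ⟨t₀, -, h⟩ := h
  have hε1 : ε < 1 := hε'.trans (by rw [Real.exp_lt_one_iff]; norm_num)
  obtain ⟨M, hM⟩ := exists_nat_gt t₀
  refine exists_rational_of_uniform_approx (M := M) hε hε' fun m hm => ?_
  have hsum : ∑ j, (Pi.single i m : Fin n → ℕ) j = m := by simp
  obtain ⟨p, q, hpq, hlt, hq⟩ := h (Pi.single i m) (Or.inl (by
    rw [hsum]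
    exact hM.trans_le (Nat.cast_le.2 hm)))
  have hq0 : ∀ j, j ≠ i → q j = 0 := by
    intro j hj
    apply eq_zero_of_absF_ofPoly_lt_one
    have := hq j
    rw [Pi.single_eq_of_ne hj, Nat.cast_zero, Real.exp_zero, mul_one] at this
    exact this.trans hε1
  have hs : ∑ j, y j * ofPoly k (q j) = y i * ofPoly k (q i) :=
    Finset.sum_eq_single i (fun j _ hj => by rw [hq0 j hj, map_zero, mul_zero]) (by simp)
  rw [hsum, hs] at hlt
  refine ⟨p, q i, fun hqi => hpq ?_, hlt, by simpa using hq i⟩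
  have hp : p = 0 := by
    apply eq_zero_of_absF_ofPoly_lt_one
    rw [hqi, map_zero, mul_zero, zero_sub, absF_neg] at hlt
    exact hlt.trans_le ((div_le_self hε.le (Real.one_le_exp (Nat.cast_nonneg m))).trans hε1.le)
  have hqz : q = 0 := by
    funext j
    by_cases hj : j = i
    · rw [hj, hqi, Pi.zero_apply]
    · rw [hq0 j hj, Pi.zero_apply]
  rw [hp, hqz, Prod.mk_zero_zero]

/-! ### Null sets of Haar measure -/

theorem tendsto_single_natCast_nhds_zero :
    Tendsto (fun m : ℕ => (HahnSeries.single (m : ℤ) (1 : k) : F k)) atTop (𝓝 0) := by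
  rw [(Valued.hasBasis_nhds_zero (F k) (WithZero (Multiplicative ℤ))).tendsto_right_iff]
  rintro γ -
  obtain ⟨a, ha⟩ : ∃ a : F k, Valued.v.restrict a = γ.1 :=
    MonoidWithZeroHom.ValueGroup₀.restrict₀_surjective _ γ.1
  have ha0 : (Valued.v a : WithZero (Multiplicative ℤ)) ≠ 0 := by
    rw [Valuation.ne_zero_iff]
    rintro rfl
    exact γ.ne_zero (by rw [← ha, map_zero])
  filter_upwards [eventually_gt_atTop (-WithZero.log (Valued.v a)).toNat] with m hm
  rw [← ha, Valuation.restrict_lt_iff, LaurentSeries.valuation_single_zpow,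
    ← WithZero.lt_log_iff_exp_lt ha0]
  omega

/-- Haar measure on `F` has no atoms. All singletons have the same measure, and infinitely many of
them lie in the compact set consisting of `0` and the powers of `T⁻¹`, whose measure is finite. -/
theorem addHaar_nullSingletonClass [MeasurableSpace (F k)] [BorelSpace (F k)]
    (μ : Measure (F k)) [μ.IsAddHaarMeasure] : NullSingletonClass μ := by
  refine ⟨fun x => ?_⟩
  rw [Measure.addHaar_singleton]
  by_contra h
  have hK := (tendsto_single_natCast_nhds_zero (k := k)).isCompact_insert_range
  have hinj : Function.Injective fun m : ℕ => (HahnSeries.single (m : ℤ) (1 : k) : F k) := by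
    intro a b hab
    have := congrArg HahnSeries.order hab
    simpa using this
  exact absurd (((Set.infinite_range_of_injective hinj).mono (Set.subset_insert 0 _)).meas_eq_top
    ⟨_, h, fun x _ => (Measure.addHaar_singleton μ x).ge⟩) hK.measure_lt_top.ne

theorem countable_setOf_eval_rational [Finite k] {f : Polynomial (F k)}
    (hf : ∀ c, f ≠ Polynomial.C c) :
    {x | ∃ p q : Polynomial k, f.eval x = ofPoly k p / ofPoly k q}.Countable := by
  have : Countable (Polynomial k) :=
    Cardinal.mk_le_aleph0_iff.1
      (Polynomial.cardinalMk_le_max.trans (max_le Cardinal.mk_le_aleph0 le_rfl))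
  have h : {x | ∃ p q : Polynomial k, f.eval x = ofPoly k p / ofPoly k q} =
      ⋃ p : Polynomial k, ⋃ q : Polynomial k,
        {x | (f - Polynomial.C (ofPoly k p / ofPoly k q)).IsRoot x} := by
    ext x
    simp [sub_eq_zero]
  rw [h]
  exact Set.countable_iUnion fun p => Set.countable_iUnion fun q =>
    (Polynomial.finite_setOfPred_isRoot (sub_ne_zero.2 (hf _))).countable

end FunctionFieldDirichlet

theorem theorem1p2 (k : Type*) [Field k] [Finite k]
    [MeasurableSpace (FunctionFieldDirichlet.F k)] [BorelSpace (FunctionFieldDirichlet.F k)]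
    (μ : Measure (FunctionFieldDirichlet.F k)) [μ.IsAddHaarMeasure]
    (n : ℕ) (hn : 1 ≤ n) (f : Fin n → Polynomial (FunctionFieldDirichlet.F k))
    (hf : LinearIndependent (FunctionFieldDirichlet.F k)
      (Fin.cons 1 f : Fin (n + 1) → Polynomial (FunctionFieldDirichlet.F k)))
    (U : Set (FunctionFieldDirichlet.F k)) (hU : IsOpen U) :
    ∃ ε₀ : ℝ, 0 < ε₀ ∧ ∀ ε : ℝ, 0 < ε → ε < ε₀ →
      ∀ᵐ x ∂μ, x ∈ U →
        ¬ FunctionFieldDirichlet.DirichletImprovable ε (fun i => (f i).eval x) := by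
  refine ⟨Real.exp (-1), Real.exp_pos _, fun ε hε hε' => ?_⟩
  let i : Fin n := ⟨0, hn⟩
  have hconst : ∀ c, f i ≠ Polynomial.C c := by
    intro c hc
    refine hf.notMem_span_image (s := {0}) (x := i.succ) (by simp) ?_
    rw [Set.image_singleton, Fin.cons_succ, Fin.cons_zero, hc, ← Polynomial.algebraMap_eq,
      Algebra.algebraMap_eq_smul_one]
    exact Submodule.smul_mem _ c (Submodule.mem_span_singleton_self 1)
  have := FunctionFieldDirichlet.addHaar_nullSingletonClass μ
  refine measure_mono_null (fun x hx => ?_)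
    ((FunctionFieldDirichlet.countable_setOf_eval_rational hconst).measure_zero μ)
  have himp : FunctionFieldDirichlet.DirichletImprovable ε (fun j => (f j).eval x) := by
    by_contra h
    exact hx fun _ => h
  exact himp.exists_rational hε hε' i
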